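/- Let $\mathbb F_q$ be a finite field, let $m\ge 1$ with $\gcd(m,q)=1$, let $s\ge 0$, and let $C\subseteq\mathbb F_q^{sm}$ be a quasi-cyclic code of length $sm$ and index $s$, i.e. a linear code invariant under the simultaneous cyclic shift $\sigma$ of its $s$ blocks of $m$ coordinates. Put $\mathcal R_m=\mathbb F_q[x]/(x^m-1)$, with conjugation $\overline{v(x)}=v(x^{-1})=v(x^{m-1})$, and $\phi(c)=(c_1(x),\dots,c_s(x))\in\mathcal R_m^s$ with $c_i(x)=\sum_{j=0}^{m-1}c_{ij}x^j$. Let $$x^m-1=\delta\, g_0g_1\cdots g_r\,h_1h_1^*\cdots h_th_t^*$$ be a factorization over $\mathbb F_q$ into irreducible polynomials, where $\delta\in\mathbb F_q^*$, $g_0=x-1$, each $g_i$ is associated with its reciprocal polynomial, and $h_j^*$ is the reciprocal polynomial of $h_j$. Let $G_i$, $H_j'$, $H_j''$ be the minimal ideals of $\mathcal R_m$ generated by $\frac{x^m-1}{g_i}$, $\frac{x^m-1}{h_j}$, $\frac{x^m-1}{h_j^*}$ respectively; they are fields, isomorphic to $\mathbb F_q[x]/(g_i)$, $\mathbb F_q[x]/(h_j)$,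 $\mathbb F_q[x]/(h_j^*)$. Let $$\phi(C)=\Big(\bigoplus_{i=0}^r C_i\Big)\oplus\Big(\bigoplus_{j=1}^t (C_j'\oplus C_j'')\Big)$$ be the corresponding decomposition, so $C_i=\phi(C)\cap G_i^s$, $C_j'=\phi(C)\cap (H_j')^s$, $C_j''=\phi(C)\cap (H_j'')^s$. Let $C_\pi\subseteq\mathbb F_q^s$ be the code of all $w=(w_1,\dots,w_s)$ such that the vector whose $i$-th block is constantly $w_i$ for every $i$ lies in $C$. The Euclidean inner product is $\sum_i u_iv_i$ and the Hermitian inner product on $\mathcal R_m^s$ is $\sum_i u_i\overline{v_i}$. Duals of codes over $\mathbb F_q$, $G_i$, $H_j'$, $H_j''$ are taken in $\mathbb F_q^{n}$ ($n$ being the length of the code), $G_i^s$, $(H_j')^s$, $(H_j'')^s$ respectively, and a code is LCD if it meets its dual only in $\mathbf 0$. In the mixed conditions in (iii) below, the fields $H_j'$ and $H_j''$ are identified through conjugation, so that $(C_j')^\perp$ (the Euclidean dual in $(H_j')^s$) is regarded as the code $\overline{(C_j')^\perp}\subseteq (H_j'')^s$, and $(C_j'')^\perp$ as $\overline{(C_j'')^\perp}\subseteq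 (H_j')^s$. Then $C_\pi=C_0$ under the identification $G_0\cong\mathbb F_q$ given by evaluation at $x=1$, and $C$ is Euclidean LCD if and only if all of the following hold: (i) $C_\pi=C_0$ is Euclidean LCD; (ii) $C_i$ is Hermitian LCD for $i=1,\dots,r$; (iii) $C_j''\cap (C_j')^\perp=\{\mathbf 0\}$ and $C_j'\cap (C_j'')^\perp=\{\mathbf 0\}$ for $j=1,\dots,t$, where $\perp$ is with respect to the Euclidean inner product. -/

import Mathlib

open Polynomial

noncomputable section

namespace QC

/-! ### Linear codes over a commutative ring and the Euclidean inner product -/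

/-- The Euclidean inner product `u · v = ∑ i, u i * v i`. -/
def euclid {R ι : Type*} [CommRing R] [Fintype ι] (u v : ι → R) : R :=
  ∑ i, u i * v i

/-- The Euclidean dual of a linear code `A`, in the full space `R ^ ι`. -/
def euclidDual {R ι : Type*} [CommRing R] [Fintype ι] (A : Submodule R (ι → R)) :
    Submodule R (ι → R) where
  carrier := {v | ∀ u ∈ A, euclid u v = 0}
  zero_mem' := by intro u _; simp [euclid]
  add_mem' := by
    intro a b ha hb u hu
    have h1 := ha u hu
    have h2 := hb u hu
    simp only [euclid] at h1 h2 ⊢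
    simp [mul_add, Finset.sum_add_distrib, h1, h2]
  smul_mem' := by
    intro r a ha u hu
    have h1 := ha u hu
    simp only [euclid] at h1 ⊢
    simp [mul_left_comm _ r, ← Finset.mul_sum, h1]

/-- `A` is Euclidean LCD: `A ∩ A^⊥ = {0}`. -/
def IsEuclidLCD {R ι : Type*} [CommRing R] [Fintype ι] (A : Submodule R (ι → R)) : Prop :=
  A ⊓ euclidDual A = ⊥

/-- `I ^ s` inside `R ^ s`, for an ideal `I` of `R`. -/
def idealPow {R : Type*} [CommRing R] (I : Ideal R) (s : ℕ) : Submodule R (Fin s → R) :=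
  Submodule.pi Set.univ (fun _ => I)

/-- The Euclidean dual, inside `I ^ s`, of a linear code `A` over `I` of length `s`. -/
def euclidDualIn {R : Type*} [CommRing R] (I : Ideal R) {s : ℕ}
    (A : Submodule R (Fin s → R)) : Submodule R (Fin s → R) :=
  idealPow I s ⊓ euclidDual A

/-- The linear code `A` over `I` is Euclidean LCD. -/
def IsEuclidLCDIn {R : Type*} [CommRing R] (I : Ideal R) {s : ℕ}
    (A : Submodule R (Fin s → R)) : Prop :=
  A ⊓ euclidDualIn I A = ⊥

/-! ### Quasi-cyclic codes -/

/-- The permutation of the `s * m` coordinates, arranged in `s` blocks of length `m`, that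
shifts every block cyclically: it is a product of `s` disjoint `m`-cycles. -/
def blockShift (s m : ℕ) : Equiv.Perm (Fin s × Fin m) :=
  Equiv.prodCongr (Equiv.refl (Fin s)) (finRotate m)

/-- The action of `blockShift` on vectors: each block `(c_0, …, c_{m-1})` becomes
`(c_{m-1}, c_0, …, c_{m-2})`. -/
def shift {F : Type*} {s m : ℕ} (c : Fin s × Fin m → F) : Fin s × Fin m → F :=
  fun p => c ((blockShift s m).symm p)

/-- `C`, of length `s * m`, is quasi-cyclic of index `s`. -/
def IsQuasiCyclic {F : Type*} [Field F] {s m : ℕ}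
    (C : Submodule F (Fin s × Fin m → F)) : Prop :=
  ∀ c ∈ C, shift c ∈ C

/-- The fixed subcode `F_σ(C)`. -/
def fixedSubcode {F : Type*} [Field F] {s m : ℕ}
    (C : Submodule F (Fin s × Fin m → F)) : Submodule F (Fin s × Fin m → F) where
  carrier := {v | v ∈ C ∧ shift v = v}
  zero_mem' := ⟨C.zero_mem, rfl⟩
  add_mem' := by
    rintro a b ⟨ha, ha'⟩ ⟨hb, hb'⟩
    refine ⟨C.add_mem ha hb, ?_⟩
    conv_rhs => rw [← ha', ← hb']
    rfl
  smul_mem' := by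
    rintro r a ⟨ha, ha'⟩
    refine ⟨C.smul_mem r ha, ?_⟩
    conv_rhs => rw [← ha']
    rfl

/-- The projection code `C_π = π(F_σ(C))`, where `π` sends a vector that is constant on every
block to the vector of these constants. -/
def projCode {F : Type*} [Field F] {s m : ℕ}
    (C : Submodule F (Fin s × Fin m → F)) : Submodule F (Fin s → F) where
  carrier := {w | ∃ v ∈ fixedSubcode C, ∀ i j, v (i, j) = w i}
  zero_mem' := ⟨0, Submodule.zero_mem _, fun _ _ => rfl⟩
  add_mem' := by
    rintro a b ⟨v, hv, hva⟩ ⟨w, hw, hwb⟩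
    exact ⟨v + w, Submodule.add_mem _ hv hw, fun i j => by simp [hva, hwb]⟩
  smul_mem' := by
    rintro r a ⟨v, hv, hva⟩
    exact ⟨r • v, Submodule.smul_mem _ r hv, fun i j => by simp [hva]⟩

/-! ### The ring `R_m = F[x] / (x^m - 1)` -/

/-- `R_m = F[x] / (x^m - 1)`. -/
abbrev CycRing (F : Type*) [Field F] (m : ℕ) : Type _ :=
  AdjoinRoot (X ^ m - 1 : F[X])

/-- The class of `x` in `R_m`. -/
abbrev xbar (F : Type*) [Field F] (m : ℕ) : CycRing F m :=
  AdjoinRoot.root (X ^ m - 1 : F[X])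

theorem xbar_pow (F : Type*) [Field F] (m : ℕ) : xbar F m ^ m = 1 := by
  have h := AdjoinRoot.eval₂_root (X ^ m - 1 : F[X])
  simpa [sub_eq_zero] using h

/-- The conjugation `v(x) ↦ v(x⁻¹) = v(x^(m-1))` of `R_m`. -/
def conj (F : Type*) [Field F] (m : ℕ) : CycRing F m →+* CycRing F m :=
  AdjoinRoot.lift (AdjoinRoot.of (X ^ m - 1 : F[X])) (xbar F m ^ (m - 1)) (by
    have h : (xbar F m ^ (m - 1)) ^ m = 1 := by
      rw [← pow_mul, mul_comm, pow_mul, xbar_pow, one_pow]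
    simp [h])

/-- Evaluation at `1`, a ring homomorphism `R_m → F`; it factors through the isomorphism
`F[x] / (x - 1) ≅ F`. -/
def evalOne (F : Type*) [Field F] (m : ℕ) : CycRing F m →+* F :=
  AdjoinRoot.lift (RingHom.id F) 1 (by simp)

/-- The ideal of `R_m` generated by `(x^m - 1) / f`, for a divisor `f` of `x^m - 1`; it is
isomorphic to `F[x] / (f)` when `f` is irreducible and `gcd(m, q) = 1`. -/
def compIdeal {F : Type*} [Field F] (m : ℕ) (f : F[X]) : Ideal (CycRing F m) :=
  Ideal.span {AdjoinRoot.mk (X ^ m - 1 : F[X]) ((X ^ m - 1) / f)}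

/-- The Hermitian inner product `∑ i, u i * conj (v i)` on `R_m ^ s`. -/
def herm {F : Type*} [Field F] {m s : ℕ} (u v : Fin s → CycRing F m) : CycRing F m :=
  ∑ i, u i * conj F m (v i)

/-- The Hermitian dual, inside `I ^ s`, of a linear code `A` over `I` of length `s`. -/
def hermDualIn {F : Type*} [Field F] {m s : ℕ} (I : Ideal (CycRing F m))
    (A : Submodule (CycRing F m) (Fin s → CycRing F m)) :
    Submodule (CycRing F m) (Fin s → CycRing F m) where
  carrier := {v | v ∈ idealPow I s ∧ ∀ u ∈ A, herm u v = 0}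
  zero_mem' := ⟨Submodule.zero_mem _, by intro u _; simp [herm]⟩
  add_mem' := by
    rintro a b ⟨ha, ha'⟩ ⟨hb, hb'⟩
    refine ⟨Submodule.add_mem _ ha hb, fun u hu => ?_⟩
    have h1 := ha' u hu
    have h2 := hb' u hu
    simp only [herm] at h1 h2 ⊢
    simp [mul_add, Finset.sum_add_distrib, h1, h2]
  smul_mem' := by
    rintro r a ⟨ha, ha'⟩
    refine ⟨Submodule.smul_mem _ r ha, fun u hu => ?_⟩
    have h1 := ha' u hu
    simp only [herm] at h1 ⊢
    simp [mul_left_comm _ (conj F m r), ← Finset.mul_sum, h1]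

/-- The linear code `A` over `I` is Hermitian LCD. -/
def IsHermLCDIn {F : Type*} [Field F] {m s : ℕ} (I : Ideal (CycRing F m))
    (A : Submodule (CycRing F m) (Fin s → CycRing F m)) : Prop :=
  A ⊓ hermDualIn I A = ⊥

/-- The conjugate code `{v | conj v ∈ A}` (equal to `{conj v | v ∈ A}`, conjugation being an
involution of `R_m`). It transports codes over `F[x]/(h)` to codes over `F[x]/(h*)` and back,
along the field isomorphism `x ↦ x⁻¹`. -/
def conjCode {F : Type*} [Field F] {m s : ℕ}
    (A : Submodule (CycRing F m) (Fin s → CycRing F m)) :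
    Submodule (CycRing F m) (Fin s → CycRing F m) where
  carrier := {v | (fun i => conj F m (v i)) ∈ A}
  zero_mem' := by
    have h : (fun i : Fin s => conj F m ((0 : Fin s → CycRing F m) i)) = 0 := by
      ext i; simp
    simp only [Set.mem_ofPred_eq, h]
    exact A.zero_mem
  add_mem' := by
    intro a b ha hb
    have h : (fun i => conj F m ((a + b) i)) =
        (fun i => conj F m (a i)) + fun i => conj F m (b i) := by
      ext i; simp
    simp only [Set.mem_ofPred_eq, h]
    exact A.add_mem ha hb
  smul_mem' := by
    intro r a ha
    have h : (fun i => conj F m ((r • a) i)) =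
        conj F m r • fun i => conj F m (a i) := by
      ext i; simp
    simp only [Set.mem_ofPred_eq, h]
    exact A.smul_mem _ ha

/-! ### The polynomial representation of a quasi-cyclic code and its constituents -/

/-- `φ(c) = (c_1(x), …, c_s(x))` with `c_i(x) = ∑ j, c (i, j) x^j`. -/
def phi (F : Type*) [Field F] (s m : ℕ) :
    (Fin s × Fin m → F) →ₗ[F] (Fin s → CycRing F m) where
  toFun c := fun i => ∑ j : Fin m, c (i, j) • xbar F m ^ (j : ℕ)
  map_add' a b := by ext i; simp [add_smul, Finset.sum_add_distrib]
  map_smul' r a := by ext i; simp [mul_smul, Finset.smul_sum]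

theorem phi_shift {F : Type*} [Field F] {s m : ℕ} (c : Fin s × Fin m → F) :
    phi F s m (shift c) = xbar F m • phi F s m c := by
  ext i
  simp only [phi, LinearMap.coe_mk, AddHom.coe_mk, Pi.smul_apply, smul_eq_mul,
    Finset.mul_sum]
  rw [← Equiv.sum_comp (finRotate m)]
  refine Finset.sum_congr rfl fun j _ => ?_
  have h1 : shift c (i, finRotate m j) = c (i, j) := by
    show c (i, (finRotate m).symm (finRotate m j)) = c (i, j)
    rw [Equiv.symm_apply_apply]
  have h2 : xbar F m ^ ((finRotate m j : Fin m) : ℕ) = xbar F m * xbar F m ^ (j : ℕ) := by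
    cases m with
    | zero => exact j.elim0
    | succ n =>
      rw [← pow_succ', coe_finRotate]
      split_ifs with h
      · subst h
        simp [xbar_pow]
      · rfl
  rw [h1, h2, mul_smul_comm]

theorem smul_mem_phi {F : Type*} [Field F] {s m : ℕ} {C : Submodule F (Fin s × Fin m → F)}
    (hC : IsQuasiCyclic C) (r : CycRing F m) (v : Fin s → CycRing F m)
    (hv : v ∈ C.map (phi F s m)) : r • v ∈ C.map (phi F s m) := by
  have hx : ∀ n : ℕ, xbar F m ^ n • v ∈ C.map (phi F s m) := by
    intro n
    induction n with
    | zero => simpa using hv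
    | succ n ih =>
      obtain ⟨c, hc, hcv⟩ := ih
      refine ⟨shift c, hC c hc, ?_⟩
      rw [phi_shift, hcv, pow_succ', mul_smul]
  induction r using AdjoinRoot.induction_on with
  | ih p =>
    induction p using Polynomial.induction_on' with
    | add p q hp hq => rw [map_add, add_smul]; exact Submodule.add_mem _ hp hq
    | monomial n a =>
      have h : AdjoinRoot.mk (X ^ m - 1 : F[X]) (monomial n a) = a • xbar F m ^ n := by
        rw [← C_mul_X_pow_eq_monomial, map_mul, map_pow, AdjoinRoot.mk_X, AdjoinRoot.mk_C,
          Algebra.smul_def]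
        rfl
      rw [h, smul_assoc]
      exact Submodule.smul_mem _ a (hx n)

/-- `φ(C)`, a linear code over `R_m` of length `s`, for a quasi-cyclic code `C`. -/
def phiCode {F : Type*} [Field F] {s m : ℕ} (C : Submodule F (Fin s × Fin m → F))
    (hC : IsQuasiCyclic C) : Submodule (CycRing F m) (Fin s → CycRing F m) where
  carrier := {v | ∃ c ∈ C, phi F s m c = v}
  zero_mem' := (C.map (phi F s m)).zero_mem
  add_mem' := fun ha hb => (C.map (phi F s m)).add_mem ha hb
  smul_mem' := fun r v hv => smul_mem_phi hC r v hv

/-- The constituent of `C` over the minimal ideal `(((x^m - 1) / f))` of `R_m`: the summand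
of `φ(C)` in the decomposition of `φ(C)` along the decomposition of `R_m ^ s` into the `s`-th
powers of the minimal ideals. Since `φ(C)` is an `R_m`-submodule, this summand is
`φ(C) ∩ I ^ s`, where `I` is that ideal. -/
def constituent {F : Type*} [Field F] {s m : ℕ} (C : Submodule F (Fin s × Fin m → F))
    (hC : IsQuasiCyclic C) (f : F[X]) : Submodule (CycRing F m) (Fin s → CycRing F m) :=
  phiCode C hC ⊓ idealPow (compIdeal m f) s

/-- The factorization `x^m - 1 = δ g_0 g_1 ⋯ g_r h_1 h_1* ⋯ h_t h_t*` into irreducible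
polynomials, with `g_0 = x - 1`, every `g_i` associated with its reciprocal polynomial, and
`h*` the reciprocal polynomial of `h`. -/
structure IsReciprocalFactorization {F : Type*} [Field F] (m : ℕ) {r t : ℕ} (δ : F)
    (g : Fin (r + 1) → F[X]) (h : Fin t → F[X]) : Prop where
  delta_ne_zero : δ ≠ 0
  g_zero : g 0 = X - 1
  g_irreducible : ∀ i, Irreducible (g i)
  g_associated : ∀ i, Associated (g i) (g i).reverse
  h_irreducible : ∀ j, Irreducible (h j)
  h_reverse_irreducible : ∀ j, Irreducible (h j).reverse
  prod_eq : (X ^ m - 1 : F[X]) = C δ * (∏ i, g i) * ∏ j, (h j * (h j).reverse)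

end QC

end

/-! The powers of `x` are orthonormal for the form "coefficient of `x^0` in `u * conj v`", so that
coefficient of `herm (φ c) (φ d)` is the Euclidean product of `c` and `d`. Multiplying by powers of
`x`, which preserve `φ(C)`, recovers the other coefficients. Hence `C` is LCD iff the Hermitian hull
of `φ(C)` vanishes (`isEuclidLCD_iff_herm`).

Since `x^m - 1` is separable, the ideal attached to a factor `f` is the annihilator of `f` and has
its own unit element. Conjugation carries the ideal of `f` to that of `f.reverse`, so a vector over
the first is tested only by the constituent at `f.reverse`. The hull therefore splits factor by
factor (`isEuclidLCD_iff_constituent`): each `g i` is paired with itself, and `h j` with its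
reciprocal.

At `x - 1` the ring acts through evaluation at `1`, which conjugation preserves. There Hermitian and
Euclidean products agree, and evaluation identifies the constituent with `C_π`. -/

namespace QC

/-! ### The constant-coefficient form on `R_m` -/

section CoefficientFunctional

variable {F : Type*} [Field F] {m : ℕ}

theorem monic_X_pow_sub_one (F : Type*) [Field F] {m : ℕ} (hm : m ≠ 0) :
    (X ^ m - 1 : F[X]).Monic := by
  simpa using monic_X_pow_sub_C (1 : F) hm

/-- The coefficient of `x^0` of an element of `R_m`. -/
noncomputable def coeffZero (F : Type*) [Field F] {m : ℕ} (hm : m ≠ 0) : CycRing F m →ₗ[F] F :=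
  (lcoeff F 0).comp (AdjoinRoot.modByMonicHom (monic_X_pow_sub_one F hm))

theorem coeffZero_xbar_pow (hm : m ≠ 0) {n : ℕ} (hn : n < m) :
    coeffZero F hm (xbar F m ^ n) = if n = 0 then 1 else 0 := by
  have h : (X ^ n : F[X]) %ₘ (X ^ m - 1) = X ^ n := by
    rw [modByMonic_eq_self_iff (monic_X_pow_sub_one F hm)]
    have : (X ^ m - 1 : F[X]).degree = m := by
      simpa using degree_X_pow_sub_C (Nat.pos_of_ne_zero hm) (1 : F)
    rw [this, degree_X_pow]
    exact_mod_cast hn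
  have h2 : xbar F m ^ n = AdjoinRoot.mk (X ^ m - 1 : F[X]) (X ^ n) := by simp
  simp only [coeffZero, LinearMap.comp_apply, h2, AdjoinRoot.modByMonicHom_mk, h, lcoeff_apply,
    coeff_X_pow]
  simp [eq_comm]

theorem conj_xbar (F : Type*) [Field F] (m : ℕ) : conj F m (xbar F m) = xbar F m ^ (m - 1) := by
  simp [conj]

theorem conj_of (a : F) : conj F m (AdjoinRoot.of (X ^ m - 1 : F[X]) a) =
    AdjoinRoot.of (X ^ m - 1 : F[X]) a := by
  simp [conj]

theorem conj_smul (a : F) (r : CycRing F m) : conj F m (a • r) = a • conj F m r := by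
  have h : ∀ v : CycRing F m, a • v = AdjoinRoot.of (X ^ m - 1 : F[X]) a * v := fun v => by
    rw [Algebra.smul_def]; rfl
  rw [h, h, map_mul, conj_of]

theorem xbar_mul_conj (hm : m ≠ 0) : xbar F m * conj F m (xbar F m) = 1 := by
  rw [conj_xbar, ← pow_succ', Nat.sub_add_cancel (Nat.pos_of_ne_zero hm), xbar_pow]

theorem conj_conj (hm : m ≠ 0) (r : CycRing F m) : conj F m (conj F m r) = r := by
  have h1 : conj F m (conj F m (xbar F m)) = xbar F m := by
    have h := congrArg (conj F m) (xbar_mul_conj (F := F) hm)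
    rw [map_mul, map_one] at h
    calc _ = (xbar F m * conj F m (xbar F m)) * conj F m (conj F m (xbar F m)) := by
          rw [xbar_mul_conj hm, one_mul]
      _ = _ := by rw [mul_assoc, h, mul_one]
  have h2 : (conj F m).comp (conj F m) = RingHom.id _ := by
    refine AdjoinRoot.ringHom_ext ?_ ?_
    · ext a; simp [conj_of]
    · simpa using h1
  exact RingHom.congr_fun h2 r

/-- Conjugation inverts `x`, so the product is `x^(j-l)`, and `|j - l| < m`. -/
theorem coeffZero_pow_mul_conj (hm : m ≠ 0) (j l : Fin m) :
    coeffZero F hm (xbar F m ^ (j : ℕ) * conj F m (xbar F m ^ (l : ℕ))) =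
      if j = l then 1 else 0 := by
  have hx : ∀ n : ℕ, xbar F m ^ n * conj F m (xbar F m ^ n) = 1 := fun n => by
    rw [map_pow, ← mul_pow, xbar_mul_conj hm, one_pow]
  rcases le_or_gt l j with h | h
  · have e : xbar F m ^ (j : ℕ) = xbar F m ^ ((j : ℕ) - l) * xbar F m ^ (l : ℕ) := by
      rw [← pow_add, Nat.sub_add_cancel h]
    rw [e, mul_assoc, hx, mul_one, coeffZero_xbar_pow hm (by omega)]
    congr 1
    simp only [Fin.ext_iff, eq_iff_iff]
    have : (l : ℕ) ≤ j := h
    omega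
  · have h' : (j : ℕ) < l := h
    -- Adding `m` brings the negative exponent `j - l` strictly between `0` and `m`.
    have e : xbar F m ^ (j : ℕ) = xbar F m ^ ((j : ℕ) + m - l) * xbar F m ^ (l : ℕ) := by
      rw [← pow_add, Nat.sub_add_cancel (by omega), pow_add, xbar_pow, mul_one]
    rw [e, mul_assoc, hx, mul_one, coeffZero_xbar_pow hm (by omega), if_neg (by omega),
      if_neg h.ne]

theorem exists_eq_sum_xbar_pow (hm : m ≠ 0) (r : CycRing F m) :
    ∃ a : Fin m → F, r = ∑ j, a j • xbar F m ^ (j : ℕ) := by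
  obtain ⟨p, rfl⟩ := AdjoinRoot.mk_surjective r
  have hP := monic_X_pow_sub_one F hm
  have hdeg : (p %ₘ (X ^ m - 1)).natDegree < m := by
    have h1 : (X ^ m - 1 : F[X]).natDegree = m := by
      simpa using natDegree_X_pow_sub_C (n := m) (r := (1 : F))
    have := natDegree_modByMonic_lt p hP (by
      intro h; rw [h] at h1; simp at h1; exact hm h1.symm)
    omega
  refine ⟨fun j => (p %ₘ (X ^ m - 1)).coeff j, ?_⟩
  have h2 : AdjoinRoot.mk (X ^ m - 1 : F[X]) p = AdjoinRoot.mk _ (p %ₘ (X ^ m - 1)) := by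
    rw [AdjoinRoot.mk_eq_mk]
    exact ⟨p /ₘ (X ^ m - 1), by linear_combination -(modByMonic_add_div p (X ^ m - 1))⟩
  rw [h2, Fin.sum_univ_eq_sum_range
    (fun j => (p %ₘ (X ^ m - 1)).coeff j • xbar F m ^ j) m]
  conv_lhs => rw [as_sum_range' _ m hdeg]
  rw [map_sum]
  refine Finset.sum_congr rfl fun n _ => ?_
  rw [← C_mul_X_pow_eq_monomial, map_mul, map_pow, AdjoinRoot.mk_X, AdjoinRoot.mk_C,
    Algebra.smul_def]
  rfl

theorem coeffZero_sum_mul_conj (hm : m ≠ 0) (a : Fin m → F) (l : Fin m) :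
    coeffZero F hm ((∑ j, a j • xbar F m ^ (j : ℕ)) * conj F m (xbar F m ^ (l : ℕ))) = a l := by
  simp [Finset.sum_mul, coeffZero_pow_mul_conj, -map_pow]

/-- Nondegeneracy of the form: multiplying by `x^((m-1)l)`, that is `x^(-l)`, moves the `l`-th
coefficient to the constant place. -/
theorem eq_zero_of_coeffZero_pow_mul (hm : m ≠ 0) {r : CycRing F m}
    (h : ∀ n, coeffZero F hm (xbar F m ^ n * r) = 0) : r = 0 := by
  obtain ⟨a, rfl⟩ := exists_eq_sum_xbar_pow hm r
  refine Finset.sum_eq_zero fun l _ => ?_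
  rw [← coeffZero_sum_mul_conj hm a l, map_pow, conj_xbar, ← pow_mul, mul_comm, h, zero_smul]

theorem phi_injective (hm : m ≠ 0) (s : ℕ) : Function.Injective (phi F s m) := by
  intro c d h
  ext ⟨i, l⟩
  have h1 : ∀ c : Fin s × Fin m → F,
      coeffZero F hm (phi F s m c i * conj F m (xbar F m ^ (l : ℕ))) = c (i, l) := fun c =>
    coeffZero_sum_mul_conj hm (fun j => c (i, j)) l
  rw [← h1 c, ← h1 d, h]

theorem coeffZero_herm_phi (hm : m ≠ 0) {s : ℕ} (c d : Fin s × Fin m → F) :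
    coeffZero F hm (herm (phi F s m c) (phi F s m d)) = euclid c d := by
  simp only [herm, euclid, map_sum, Fintype.sum_prod_type]
  refine Finset.sum_congr rfl fun i _ => ?_
  have h : conj F m (phi F s m d i) = ∑ l, d (i, l) • conj F m (xbar F m ^ (l : ℕ)) := by
    simp only [phi, LinearMap.coe_mk, AddHom.coe_mk, map_sum, conj_smul]
  rw [h, Finset.mul_sum, map_sum]
  refine Finset.sum_congr rfl fun l _ => ?_
  rw [mul_smul_comm, map_smul, smul_eq_mul, mul_comm]
  congr 1
  exact coeffZero_sum_mul_conj hm (fun j => c (i, j)) l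

theorem herm_smul_left {s : ℕ} (r : CycRing F m) (u v : Fin s → CycRing F m) :
    herm (r • u) v = r * herm u v := by
  simp [herm, Finset.mul_sum, mul_assoc]

theorem herm_smul_right {s : ℕ} (r : CycRing F m) (u v : Fin s → CycRing F m) :
    herm u (r • v) = conj F m r * herm u v := by
  simp [herm, Finset.mul_sum, mul_left_comm]

/-- `C` is Euclidean LCD iff the Hermitian hull of `φ(C)` is trivial. -/
theorem isEuclidLCD_iff_herm (hm : m ≠ 0) {s : ℕ} {C : Submodule F (Fin s × Fin m → F)}
    (hC : IsQuasiCyclic C) :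
    IsEuclidLCD C ↔ ∀ v ∈ phiCode C hC, (∀ u ∈ phiCode C hC, herm u v = 0) → v = 0 := by
  unfold IsEuclidLCD
  rw [Submodule.eq_bot_iff]
  constructor
  · rintro H _ ⟨d, hd, rfl⟩ hv
    rw [H d ⟨hd, fun c hc => ?_⟩, map_zero]
    rw [← coeffZero_herm_phi hm, hv _ ⟨c, hc, rfl⟩, map_zero]
  · rintro H d ⟨hd, hd'⟩
    refine phi_injective hm s ?_
    rw [map_zero]
    -- Orthogonality in `F` controls only constant coefficients; closure of `φ(C)` under `x^n`
    -- supplies all the others.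
    refine H _ ⟨d, hd, rfl⟩ fun u hu => eq_zero_of_coeffZero_pow_mul hm fun n => ?_
    rw [← herm_smul_left]
    obtain ⟨c, hc, h⟩ := (phiCode C hC).smul_mem (xbar F m ^ n) hu
    rw [← h, coeffZero_herm_phi]
    exact hd' c hc

end CoefficientFunctional

/-! ### Ideals of factors, conjugation, and the splitting of the hull -/

section MinimalIdeals

variable {F : Type*} [Field F] {m : ℕ}

/-- For a factor `f` of the separable polynomial `x^m - 1`, the ideal `((x^m - 1) / f)` is the
annihilator of `f` and has a unit element, congruent to `1` modulo `f`. -/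
theorem exists_unit_compIdeal (hs : (X ^ m - 1 : F[X]).Separable) {f : F[X]}
    (hf : f ∣ X ^ m - 1) : ∃ a : CycRing F m,
      1 - a * AdjoinRoot.mk _ f ∈ compIdeal m f ∧
      ∀ v, v ∈ compIdeal m f ↔ AdjoinRoot.mk (X ^ m - 1 : F[X]) f * v = 0 := by
  have hmul : f * ((X ^ m - 1) / f) = X ^ m - 1 := by
    refine EuclideanDomain.mul_div_cancel' ?_ hf
    rintro rfl
    exact hs.ne_zero (zero_dvd_iff.mp hf)
  have hcop : IsCoprime f ((X ^ m - 1) / f) := by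
    refine Separable.isCoprime ?_
    rwa [hmul]
  obtain ⟨a, b, hab⟩ := hcop
  have hab' : 1 - AdjoinRoot.mk (X ^ m - 1) a * AdjoinRoot.mk (X ^ m - 1 : F[X]) f =
      AdjoinRoot.mk _ b * AdjoinRoot.mk (X ^ m - 1 : F[X]) ((X ^ m - 1) / f) := by
    rw [← map_one (AdjoinRoot.mk (X ^ m - 1 : F[X])), ← map_mul, ← map_mul, ← map_sub]
    congr 1
    linear_combination -hab
  have hmem : 1 - AdjoinRoot.mk (X ^ m - 1) a * AdjoinRoot.mk (X ^ m - 1 : F[X]) f ∈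
      compIdeal m f := by
    rw [hab']
    exact Ideal.mul_mem_left _ _ (Ideal.subset_span rfl)
  refine ⟨AdjoinRoot.mk _ a, hmem, fun v => ⟨fun hv => ?_, fun hv => ?_⟩⟩
  · obtain ⟨c, rfl⟩ := Ideal.mem_span_singleton'.mp hv
    rw [mul_left_comm, ← map_mul, hmul, AdjoinRoot.mk_self, mul_zero]
  · have : v = (1 - AdjoinRoot.mk (X ^ m - 1) a * AdjoinRoot.mk (X ^ m - 1 : F[X]) f) * v := by
      linear_combination AdjoinRoot.mk (X ^ m - 1) a * hv
    rw [this]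
    exact Ideal.mul_mem_right _ _ hmem

theorem mem_compIdeal_iff (hs : (X ^ m - 1 : F[X]).Separable) {f : F[X]}
    (hf : f ∣ X ^ m - 1) (v : CycRing F m) :
    v ∈ compIdeal m f ↔ AdjoinRoot.mk (X ^ m - 1 : F[X]) f * v = 0 :=
  (exists_unit_compIdeal hs hf).choose_spec.2 v

/-- This is `f(x⁻¹) x^(deg f) = f*(x)`. As `x` is a unit, `conj f` and `f.reverse` have the same
annihilator. -/
theorem conj_mk_mul_pow (hm : m ≠ 0) (f : F[X]) :
    conj F m (AdjoinRoot.mk _ f) * xbar F m ^ f.natDegree = AdjoinRoot.mk _ f.reverse := by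
  let _ : Invertible (conj F m (xbar F m)) := ⟨xbar F m, xbar_mul_conj hm, by
    rw [mul_comm, xbar_mul_conj hm]⟩
  have h := eval₂_reverse_mul_pow (AdjoinRoot.of (X ^ m - 1 : F[X])) (conj F m (xbar F m)) f
  have h1 : ⅟(conj F m (xbar F m)) = xbar F m := rfl
  have h2 : conj F m (AdjoinRoot.mk _ f) =
      eval₂ (AdjoinRoot.of (X ^ m - 1 : F[X])) (conj F m (xbar F m)) f := by
    rw [conj_xbar]; simp [conj]
  rw [h2, ← h, h1, mul_assoc, ← mul_pow, mul_comm (conj F m _), xbar_mul_conj hm, one_pow, mul_one]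
  exact AdjoinRoot.aeval_eq _

theorem mk_reverse_mul_conj_eq_zero_iff (hm : m ≠ 0) (f : F[X]) (v : CycRing F m) :
    AdjoinRoot.mk _ f.reverse * conj F m v = 0 ↔ AdjoinRoot.mk (X ^ m - 1 : F[X]) f * v = 0 := by
  have hu : IsUnit (xbar F m) := IsUnit.of_mul_eq_one _ (xbar_mul_conj hm)
  rw [← conj_mk_mul_pow hm, mul_right_comm, ← map_mul, (hu.pow _).mul_left_eq_zero]
  refine ⟨fun h => ?_, fun h => by rw [h, map_zero]⟩
  rw [← conj_conj hm (_ * v), h, map_zero]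

theorem conj_mem_compIdeal_reverse_iff (hm : m ≠ 0) (hs : (X ^ m - 1 : F[X]).Separable)
    {f : F[X]} (hf : f ∣ X ^ m - 1) (hf' : f.reverse ∣ X ^ m - 1) (v : CycRing F m) :
    conj F m v ∈ compIdeal m f.reverse ↔ v ∈ compIdeal m f := by
  rw [mem_compIdeal_iff hs hf, mem_compIdeal_iff hs hf', mk_reverse_mul_conj_eq_zero_iff hm]

theorem compIdeal_eq_of_associated (hs : (X ^ m - 1 : F[X]).Separable) {f f' : F[X]}
    (hf : f ∣ X ^ m - 1) (h : Associated f f') : compIdeal m f = compIdeal m f' := by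
  ext v
  rw [mem_compIdeal_iff hs hf, mem_compIdeal_iff hs (h.dvd_iff_dvd_left.mp hf)]
  obtain ⟨a, rfl⟩ := h
  rw [map_mul, mul_right_comm, (a.isUnit.map _).mul_left_eq_zero]

theorem smul_mem_idealPow {s : ℕ} {I : Ideal (CycRing F m)} {e : CycRing F m} (he : e ∈ I)
    (v : Fin s → CycRing F m) : e • v ∈ idealPow I s :=
  fun _ _ => Ideal.mul_mem_right _ _ he

/-- With `a` from `exists_unit_compIdeal`, the factor `1 - a f` is the unit element of the ideal of
`f`. -/
theorem unit_mul_eq {f : F[X]} {a v : CycRing F m} (hv : AdjoinRoot.mk _ f * v = 0) :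
    (1 - a * AdjoinRoot.mk _ f) * v = v := by
  linear_combination -a * hv

/-- If conjugation maps the ideal of `f` into that of `f'`, then for `v` over the ideal of `f`
Hermitian orthogonality to `φ(C)` is orthogonality to the constituent at `f'`. -/
theorem herm_phiCode_iff (hs : (X ^ m - 1 : F[X]).Separable) {s : ℕ}
    {C : Submodule F (Fin s × Fin m → F)} (hC : IsQuasiCyclic C) {f f' : F[X]}
    (hf' : f' ∣ X ^ m - 1) (hconj : ∀ v ∈ compIdeal m f, conj F m v ∈ compIdeal m f')
    {v : Fin s → CycRing F m} (hv : v ∈ idealPow (compIdeal m f) s) :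
    (∀ u ∈ phiCode C hC, herm u v = 0) ↔ ∀ u ∈ constituent C hC f', herm u v = 0 := by
  refine ⟨fun H u hu => H u hu.1, fun H u hu => ?_⟩
  obtain ⟨a, ha, hann⟩ := exists_unit_compIdeal hs hf'
  -- Scaling `u` by the unit element of the ideal of `f'` puts it in the constituent without
  -- changing `herm u v`, because each `conj (v i)` lies in that ideal.
  rw [← H _ ⟨(phiCode C hC).smul_mem _ hu, smul_mem_idealPow ha u⟩, herm_smul_left, herm,
    Finset.mul_sum]
  refine Finset.sum_congr rfl fun i _ => ?_
  rw [mul_left_comm, unit_mul_eq ((hann _).mp (hconj _ (hv i trivial)))]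

/-- Stands in for the direct sum decomposition of `R_m`: a representative of `v` is divisible by
each `p i`, hence by their product, the `p i` being pairwise coprime by separability. -/
theorem eq_zero_of_compIdeal_smul {ι : Type*} [Fintype ι] (hs : (X ^ m - 1 : F[X]).Separable)
    {p : ι → F[X]} {δ : F} (hδ : δ ≠ 0) (hp : X ^ m - 1 = C δ * ∏ i, p i) {v : CycRing F m}
    (h : ∀ i, ∀ e ∈ compIdeal m (p i), e * v = 0) : v = 0 := by
  classical
  obtain ⟨q, rfl⟩ := AdjoinRoot.mk_surjective v
  have hdvd : ∀ i, p i ∣ X ^ m - 1 := fun i => by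
    rw [hp]; exact (Finset.dvd_prod_of_mem _ (Finset.mem_univ i)).mul_left _
  rw [AdjoinRoot.mk_eq_zero, hp]
  have hu : IsUnit (C δ) := isUnit_C.mpr hδ.isUnit
  rw [hu.mul_left_dvd]
  refine Finset.prod_dvd_of_coprime ?_ fun i _ => ?_
  · intro i _ j _ hij
    refine Separable.isCoprime (hs.of_dvd ?_)
    rw [hp, ← Finset.prod_pair hij]
    exact (Finset.prod_dvd_prod_of_subset _ _ _ (Finset.subset_univ _)).mul_left _
  · obtain ⟨a, ha, -⟩ := exists_unit_compIdeal hs (hdvd i)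
    have := h i _ ha
    obtain ⟨b, rfl⟩ := AdjoinRoot.mk_surjective a
    rw [← map_one (AdjoinRoot.mk (X ^ m - 1 : F[X])), ← map_mul, ← map_sub, ← map_mul,
      AdjoinRoot.mk_eq_zero] at this
    -- The unit element is `1 - b * p i`, congruent to `1` modulo `p i`, so `p i` divides `q`
    -- itself.
    have h3 := (hdvd i).trans this
    have : q = (1 - b * p i) * q + p i * (b * q) := by ring
    rw [this]
    exact dvd_add h3 (dvd_mul_right _ _)

/-- `C` is Euclidean LCD iff each constituent is Hermitian nondegenerate against the constituent
at the reciprocal factor. -/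
theorem isEuclidLCD_iff_constituent {ι : Type*} [Fintype ι] (hm : m ≠ 0)
    (hs : (X ^ m - 1 : F[X]).Separable) {p p' : ι → F[X]} {δ : F} (hδ : δ ≠ 0)
    (hp : X ^ m - 1 = C δ * ∏ i, p i) (hp' : ∀ i, p' i ∣ X ^ m - 1)
    (hconj : ∀ i, ∀ v ∈ compIdeal m (p i), conj F m v ∈ compIdeal m (p' i)) {s : ℕ}
    {C : Submodule F (Fin s × Fin m → F)} (hC : IsQuasiCyclic C) :
    IsEuclidLCD C ↔ ∀ i, ∀ v ∈ constituent C hC (p i),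
      (∀ u ∈ constituent C hC (p' i), herm u v = 0) → v = 0 := by
  rw [isEuclidLCD_iff_herm hm hC]
  refine ⟨fun H i v hv hu => H v hv.1 ?_, fun H v hv hu => ?_⟩
  · rwa [herm_phiCode_iff hs hC (hp' i) (hconj i) hv.2]
  · ext k
    -- A hull vector is tested one ideal at a time: `e • v` is again in the hull and lies in a
    -- single constituent.
    refine eq_zero_of_compIdeal_smul hs hδ hp fun i e he => ?_
    have hev := smul_mem_idealPow he v
    have : e • v = 0 := by
      refine H i _ ⟨(phiCode C hC).smul_mem _ hv, hev⟩ ?_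
      rw [← herm_phiCode_iff hs hC (hp' i) (hconj i) hev]
      intro u hu'
      rw [herm_smul_right, hu u hu', mul_zero]
    exact congrFun this k

end MinimalIdeals

/-! ### Evaluation at `1` on the ideal of `x - 1` -/

section TrivialFactor

variable {F : Type*} [Field F] {m : ℕ}

/-- `p(x) - p(1)` is a multiple of `x - 1`, which kills `v`. -/
theorem mul_eq_evalOne_smul {v : CycRing F m}
    (hv : AdjoinRoot.mk (X ^ m - 1 : F[X]) (X - 1) * v = 0) (r : CycRing F m) :
    r * v = evalOne F m r • v := by
  obtain ⟨p, rfl⟩ := AdjoinRoot.mk_surjective r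
  obtain ⟨q, hq⟩ := X_sub_C_dvd_sub_C_eval (a := (1 : F)) (p := p)
  have h1 : evalOne F m (AdjoinRoot.mk _ p) = p.eval 1 := by
    simp [evalOne]
  have h2 : AdjoinRoot.mk (X ^ m - 1 : F[X]) p = AdjoinRoot.mk (X ^ m - 1 : F[X]) (X - 1) *
      AdjoinRoot.mk _ q + AdjoinRoot.of _ (p.eval 1) := by
    rw [← AdjoinRoot.mk_C, ← map_mul, ← map_add]
    congr 1
    rw [C_1] at hq
    linear_combination hq
  rw [h1, Algebra.smul_def, h2]
  change _ = AdjoinRoot.of _ (p.eval 1) * v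
  linear_combination AdjoinRoot.mk _ q * hv

theorem evalOne_smul (a : F) (r : CycRing F m) : evalOne F m (a • r) = a * evalOne F m r := by
  rw [Algebra.smul_def, map_mul]
  congr 1
  simp [evalOne]

theorem evalOne_conj (r : CycRing F m) : evalOne F m (conj F m r) = evalOne F m r := by
  have h : (evalOne F m).comp (conj F m) = evalOne F m := by
    refine AdjoinRoot.ringHom_ext ?_ ?_
    · ext a; simp [conj_of]
    · simp [conj_xbar, evalOne]
  exact RingHom.congr_fun h r

/-- If `e` is the unit element of the ideal, then `u = u * e = u(1) • e`. -/
theorem evalOne_injOn_compIdeal (hs : (X ^ m - 1 : F[X]).Separable) {u v : CycRing F m}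
    (hu : u ∈ compIdeal m (X - 1 : F[X])) (hv : v ∈ compIdeal m (X - 1 : F[X]))
    (h : evalOne F m u = evalOne F m v) : u = v := by
  obtain ⟨a, ha, hann⟩ := exists_unit_compIdeal (m := m) hs (sub_one_dvd_pow_sub_one X m)
  have he := (hann _).mp ha
  rw [← unit_mul_eq (a := a) ((hann _).mp hu), ← unit_mul_eq (a := a) ((hann _).mp hv),
    mul_comm, mul_comm _ v, mul_eq_evalOne_smul he, mul_eq_evalOne_smul he, h]

end TrivialFactor

theorem apply_zero_eq_of_shift_eq {F : Type*} {s n : ℕ} {c : Fin s × Fin (n + 1) → F} (h : shift c = c)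
    (i : Fin s) (j : Fin (n + 1)) : c (i, j) = c (i, 0) := by
  induction j using Fin.induction with
  | zero => rfl
  | succ j ih =>
    rw [← ih]
    have h1 : shift c (i, finRotate (n + 1) j.castSucc) = c (i, j.castSucc) := by
      change c (i, (finRotate (n + 1)).symm (finRotate (n + 1) j.castSucc)) = _
      rw [Equiv.symm_apply_apply]
    rw [h] at h1
    rw [← h1, finRotate_apply, Fin.coeSucc_eq_succ]

/-! ### The projection code and the constituent at `x - 1` -/

section TrivialFactor

variable {F : Type*} [Field F] {m : ℕ}

theorem mk_X_sub_one_mul_eq_zero_iff (v : CycRing F m) :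
    AdjoinRoot.mk (X ^ m - 1 : F[X]) (X - 1) * v = 0 ↔ xbar F m * v = v := by
  simp [sub_mul, sub_eq_zero]

theorem evalOne_phi_of_forall_eq {s : ℕ} {c : Fin s × Fin m → F} {w : Fin s → F}
    (h : ∀ i j, c (i, j) = w i) (i : Fin s) :
    evalOne F m (phi F s m c i) = (m : F) * w i := by
  have hx : evalOne F m (xbar F m) = 1 := by simp [evalOne]
  simp [phi, evalOne_smul, h, hx]

/-- Evaluation at `1` maps the constituent at `x - 1` onto the projection code. -/
theorem mem_projCode_iff (hm : m ≠ 0) (hmF : (m : F) ≠ 0)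
    (hs : (X ^ m - 1 : F[X]).Separable) {s : ℕ} {C : Submodule F (Fin s × Fin m → F)}
    (hC : IsQuasiCyclic C) (w : Fin s → F) :
    w ∈ projCode C ↔ ∃ u ∈ constituent C hC (X - 1), ∀ i, evalOne F m (u i) = w i := by
  have hmem : ∀ v : CycRing F m, v ∈ compIdeal m (X - 1 : F[X]) ↔ xbar F m * v = v := fun v => by
    rw [mem_compIdeal_iff hs (sub_one_dvd_pow_sub_one X m), mk_X_sub_one_mul_eq_zero_iff]
  constructor
  · rintro ⟨v, ⟨hv, hvs⟩, hvw⟩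
    -- A block constantly equal to `w i` evaluates to `m * w i`, hence the factor `m⁻¹`; the
    -- converse direction rescales by `m`.
    refine ⟨phi F s m ((m : F)⁻¹ • v), ⟨⟨_, C.smul_mem _ hv, rfl⟩, fun i _ => ?_⟩, fun i => ?_⟩
    · refine (hmem _).mpr ?_
      have h := congrFun (phi_shift v) i
      rw [hvs] at h
      rw [Pi.smul_apply, smul_eq_mul] at h
      rw [map_smul, Pi.smul_apply, mul_smul_comm, ← h]
    · rw [map_smul, Pi.smul_apply, evalOne_smul, evalOne_phi_of_forall_eq hvw,
        inv_mul_cancel_left₀ hmF]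
  · rintro ⟨_, ⟨⟨c, hc, rfl⟩, hI⟩, hw⟩
    -- Being killed by `x - 1` means being fixed by `x`, which `φ` turns into shift invariance.
    have hcs : shift c = c := by
      refine phi_injective hm s ?_
      rw [phi_shift]
      ext i
      exact (hmem _).mp (hI i trivial)
    obtain ⟨n, rfl⟩ := Nat.exists_eq_succ_of_ne_zero hm
    have h0 := apply_zero_eq_of_shift_eq hcs
    refine ⟨((n + 1 : ℕ) : F) • c, (fixedSubcode C).smul_mem _ ⟨hc, hcs⟩, fun i j => ?_⟩
    rw [← hw, evalOne_phi_of_forall_eq h0, Pi.smul_apply, smul_eq_mul, h0]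

theorem herm_eq_euclid_of_mem (hs : (X ^ m - 1 : F[X]).Separable) {s : ℕ}
    {u : Fin s → CycRing F m} (hu : u ∈ idealPow (compIdeal m (X - 1)) s)
    (v : Fin s → CycRing F m) : herm u v = euclid u v := by
  refine Finset.sum_congr rfl fun i _ => ?_
  have h := (mem_compIdeal_iff hs (sub_one_dvd_pow_sub_one X m) _).mp (hu i trivial)
  rw [mul_comm, mul_comm (u i), mul_eq_evalOne_smul h, mul_eq_evalOne_smul h, evalOne_conj]

/-- `euclid u v` lies in the ideal of `x - 1` because `u` does, and evaluation is injective there.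
-/
theorem euclid_eq_zero_iff_evalOne (hs : (X ^ m - 1 : F[X]).Separable) {s : ℕ}
    {u : Fin s → CycRing F m} (hu : u ∈ idealPow (compIdeal m (X - 1)) s)
    (v : Fin s → CycRing F m) :
    euclid u v = 0 ↔ euclid (fun i => evalOne F m (u i)) (fun i => evalOne F m (v i)) = 0 := by
  have h : euclid (fun i => evalOne F m (u i)) (fun i => evalOne F m (v i)) =
      evalOne F m (euclid u v) := by simp [euclid]
  rw [h]
  refine ⟨fun h => by rw [h, map_zero], fun h => ?_⟩
  refine evalOne_injOn_compIdeal hs (Ideal.sum_mem _ fun i _ => ?_) (Ideal.zero_mem _)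
    (by rw [h, map_zero])
  exact Ideal.mul_mem_right _ _ (hu i trivial)

theorem isEuclidLCDIn_X_sub_one_iff (hs : (X ^ m - 1 : F[X]).Separable) {s : ℕ}
    {C : Submodule F (Fin s × Fin m → F)} (hC : IsQuasiCyclic C) :
    IsEuclidLCDIn (compIdeal m (X - 1)) (constituent C hC (X - 1)) ↔
      ∀ v ∈ constituent C hC (X - 1),
        (∀ u ∈ constituent C hC (X - 1), herm u v = 0) → v = 0 := by
  unfold IsEuclidLCDIn
  rw [Submodule.eq_bot_iff]
  refine ⟨fun H v hv h => H v ⟨hv, hv.2, fun u hu => ?_⟩, fun H v hv => H v hv.1 fun u hu => ?_⟩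
  · rw [← herm_eq_euclid_of_mem hs hu.2, h u hu]
  · rw [herm_eq_euclid_of_mem hs hu.2, hv.2.2 u hu]

theorem isEuclidLCD_projCode_iff (hm : m ≠ 0) (hmF : (m : F) ≠ 0)
    (hs : (X ^ m - 1 : F[X]).Separable) {s : ℕ} {C : Submodule F (Fin s × Fin m → F)}
    (hC : IsQuasiCyclic C) :
    IsEuclidLCD (projCode C) ↔
      IsEuclidLCDIn (compIdeal m (X - 1)) (constituent C hC (X - 1)) := by
  have hproj := mem_projCode_iff hm hmF hs hC
  unfold IsEuclidLCDIn IsEuclidLCD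
  rw [Submodule.eq_bot_iff, Submodule.eq_bot_iff]
  constructor
  · rintro H v ⟨hv, -, hv'⟩
    have h0 := H (fun i => evalOne F m (v i)) ⟨(hproj _).mpr ⟨v, hv, fun _ => rfl⟩, fun w hw => ?_⟩
    · ext i
      refine evalOne_injOn_compIdeal hs (hv.2 i trivial) (Ideal.zero_mem _) ?_
      exact (congrFun h0 i).trans (map_zero _).symm
    · obtain ⟨u, hu, huw⟩ := (hproj w).mp hw
      obtain rfl := funext huw
      exact (euclid_eq_zero_iff_evalOne hs hu.2 v).mp (hv' u hu)
  · rintro H w ⟨hw, hw'⟩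
    obtain ⟨v, hv, hvw⟩ := (hproj w).mp hw
    obtain rfl := funext hvw
    have h0 := H v ⟨hv, hv.2, fun u hu => ?_⟩
    · ext i
      simp [h0]
    · exact (euclid_eq_zero_iff_evalOne hs hu.2 v).mpr
        (hw' _ ((hproj _).mpr ⟨u, hu, fun _ => rfl⟩))

end TrivialFactor

/-! ### The duality conditions in Hermitian form -/

section Conditions

variable {F : Type*} [Field F] {m s : ℕ}

theorem isHermLCDIn_constituent_iff {C : Submodule F (Fin s × Fin m → F)} (hC : IsQuasiCyclic C)
    (f : F[X]) : IsHermLCDIn (compIdeal m f) (constituent C hC f) ↔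
      ∀ v ∈ constituent C hC f, (∀ u ∈ constituent C hC f, herm u v = 0) → v = 0 := by
  unfold IsHermLCDIn
  rw [Submodule.eq_bot_iff]
  exact ⟨fun H v hv h => H v ⟨hv, hv.2, h⟩, fun H v hv => H v hv.1 hv.2.2⟩

/-- `herm u v` is by definition the Euclidean product of `u` with the conjugate of `v`; `hconj`
makes the ambient condition on that conjugate automatic. -/
theorem constituent_inf_conjCode_eq_bot_iff {C : Submodule F (Fin s × Fin m → F)}
    (hC : IsQuasiCyclic C) {f f' : F[X]}
    (hconj : ∀ v ∈ compIdeal m f, conj F m v ∈ compIdeal m f') :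
    constituent C hC f ⊓ conjCode (euclidDualIn (compIdeal m f') (constituent C hC f')) = ⊥ ↔
      ∀ v ∈ constituent C hC f, (∀ u ∈ constituent C hC f', herm u v = 0) → v = 0 := by
  rw [Submodule.eq_bot_iff]
  exact ⟨fun H v hv h => H v ⟨hv, fun i _ => hconj _ (hv.2 i trivial), h⟩,
    fun H v hv => H v hv.1 hv.2.2⟩

end Conditions

end QC

/-! ### The LCD criterion -/

theorem mainTheorem7 {F : Type*} [Field F] [Fintype F] (s m : ℕ)
    (hm : Nat.Coprime m (Fintype.card F))
    {r t : ℕ} (δ : F) (g : Fin (r + 1) → Polynomial F) (h : Fin t → Polynomial F)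
    (hfac : QC.IsReciprocalFactorization m δ g h)
    (C : Submodule F (Fin s × Fin m → F)) (hC : QC.IsQuasiCyclic C) :
    -- `C_π = C_0` under the identification of `G_0` with `F` given by evaluation at `1`
    (∀ w : Fin s → F, w ∈ QC.projCode C ↔
      ∃ u ∈ QC.constituent C hC (g 0), ∀ i, QC.evalOne F m (u i) = w i) ∧
    (QC.IsEuclidLCD C ↔
      -- `C_π = C_0` is Euclidean LCD
      (QC.IsEuclidLCD (QC.projCode C) ∧
        QC.IsEuclidLCDIn (QC.compIdeal m (g 0)) (QC.constituent C hC (g 0))) ∧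
      -- `C_i` is Hermitian LCD for `i = 1, …, r`
      (∀ i : Fin r, QC.IsHermLCDIn (QC.compIdeal m (g i.succ))
        (QC.constituent C hC (g i.succ))) ∧
      -- `C_j'' ∩ (C_j')^⊥ = {0}` and `C_j' ∩ (C_j'')^⊥ = {0}`; the Euclidean dual of a code
      -- over one of the fields `H_j'`, `H_j''` is a code over the same field, and the two
      -- fields are identified through conjugation
      (∀ j : Fin t,
        QC.constituent C hC (h j).reverse ⊓
          QC.conjCode (QC.euclidDualIn (QC.compIdeal m (h j))
            (QC.constituent C hC (h j))) = ⊥ ∧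
        QC.constituent C hC (h j) ⊓
          QC.conjCode (QC.euclidDualIn (QC.compIdeal m (h j).reverse)
            (QC.constituent C hC (h j).reverse)) = ⊥)) := by
  have hmF : (m : F) ≠ 0 := by
    intro h0
    have hp := CharP.cast_eq_zero_iff F (ringChar F) m
    have h1 := hp.mp h0
    have h2 : ringChar F ∣ Fintype.card F := (CharP.cast_eq_zero_iff F (ringChar F) _).mp (by simp)
    -- The characteristic would divide both `m` and `q`.
    exact CharP.ringChar_ne_one (Nat.dvd_one.mp (hm ▸ Nat.dvd_gcd h1 h2))
  have hm0 : m ≠ 0 := by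
    rintro rfl
    simp at hmF
  have hs : (X ^ m - 1 : F[X]).Separable := by
    simpa using separable_X_pow_sub_C (1 : F) hmF one_ne_zero
  obtain ⟨hδ, hg0, -, hg, -, -, hprod⟩ := hfac
  -- `p'` is the reciprocal partner of `p`. Reciprocals precede the `h j` in `p` to match the order
  -- of the two conditions in (iii).
  let p : Fin (r + 1) ⊕ (Fin t ⊕ Fin t) → F[X] :=
    Sum.elim g (Sum.elim (fun j => (h j).reverse) h)
  let p' : Fin (r + 1) ⊕ (Fin t ⊕ Fin t) → F[X] :=
    Sum.elim g (Sum.elim h fun j => (h j).reverse)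
  have hp : X ^ m - 1 = Polynomial.C δ * ∏ i, p i := by
    rw [hprod, Fintype.prod_sum_type, Fintype.prod_sum_type, Finset.prod_mul_distrib]
    simp only [p, Sum.elim_inl, Sum.elim_inr]
    ring
  have hdvd : ∀ i, p i ∣ X ^ m - 1 := fun i => by
    rw [hp]; exact (Finset.dvd_prod_of_mem _ (Finset.mem_univ i)).mul_left _
  have hconj_g : ∀ i, ∀ v ∈ QC.compIdeal m (g i), QC.conj F m v ∈ QC.compIdeal m (g i) := by
    intro i v hv
    have hd : g i ∣ X ^ m - 1 := hdvd (Sum.inl i)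
    rw [QC.compIdeal_eq_of_associated hs hd (hg i)]
    exact (QC.conj_mem_compIdeal_reverse_iff hm0 hs hd ((hg i).dvd_iff_dvd_left.mp hd) v).mpr hv
  have hiff_h := fun j => QC.conj_mem_compIdeal_reverse_iff hm0 hs
    (hdvd (Sum.inr (Sum.inr j))) (hdvd (Sum.inr (Sum.inl j)))
  have hconj_h : ∀ j, ∀ v ∈ QC.compIdeal m (h j), QC.conj F m v ∈ QC.compIdeal m (h j).reverse :=
    fun j v hv => (hiff_h j v).mpr hv
  have hconj_r : ∀ j, ∀ v ∈ QC.compIdeal m (h j).reverse, QC.conj F m v ∈ QC.compIdeal m (h j) :=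
    fun j v hv => (hiff_h j _).mp (by rwa [QC.conj_conj hm0])
  have key := QC.isEuclidLCD_iff_constituent (p := p) (p' := p') hm0 hs hδ hp
    (by
      rintro (i | j | j)
      exacts [hdvd (Sum.inl i), hdvd (Sum.inr (Sum.inr j)), hdvd (Sum.inr (Sum.inl j))])
    (by
      rintro (i | j | j)
      exacts [hconj_g i, hconj_r j, hconj_h j]) hC
  rw [hg0]
  refine ⟨QC.mem_projCode_iff hm0 hmF hs hC, ?_⟩
  -- The two forms of (i) are equivalent, so `and_self` merges them.
  rw [key, QC.isEuclidLCD_projCode_iff hm0 hmF hs hC, and_self,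
    QC.isEuclidLCDIn_X_sub_one_iff hs hC, Sum.forall, Sum.forall, Fin.forall_fin_succ]
  simp only [QC.isHermLCDIn_constituent_iff,
    fun j => QC.constituent_inf_conjCode_eq_bot_iff hC (hconj_h j),
    fun j => QC.constituent_inf_conjCode_eq_bot_iff hC (hconj_r j), p, p', Sum.elim_inl,
    Sum.elim_inr, hg0, forall_and, and_assoc]
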